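/- Let $M$ be an oriented connected 3-manifold which is the interior of a compact manifold with boundary a single torus, and let $\mathcal T$ be an oriented ideal triangulation of $M$ with $N$ tetrahedra and hence $N$ edges, both numbered by $1,\dots,N$ arbitrarily. Label the edges of the $j$th tetrahedron in the usual way by shape parameters $z_j$, $z_j'=1/(1-z_j)$, $z_j''=1-1/z_j$ (opposite edges carry the same label; $z,z',z''$ follow in counterclockwise order as seen from each vertex), and let $G_{ij},G'_{ij},G''_{ij}$ be the number of edges of the $j$th tetrahedron labelled $z_j,z_j',z_j''$ that are identified to the $i$th edge. Let $g=(g_i)_{i=1}^N$ with $g_i(z)=\prod_{j} z_j^{G_{ij}}(z_j')^{G'_{ij}}(z_j'')^{G''_{ij}}$, and let $\mathcal V^+=\{z:\operatorname{Im}z_j>0 \text{ for all } j,\ g(z)=\mathbf 1\}$ be the positive gluing variety. Let $p(x_1,\dots,x_N)=\prod_i x_i^{K_i}$, where $K_i$ is the number of ends of the $i$th edge incident to the ideal vertex. Let $\theta$ be an oriented closed peripheral curve in normal position with respect to $\mathcal T$, and let $C_j,C_j',C_j''$ be the coefficients of its completeness equation: the signed numbers of times that $\theta$ turns around a corner of the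 vertex link labelled $z_j,z_j',z_j''$ (counted $+1$ if the corner is to the left of $\theta$ and $-1$ if it is to the right). Let $u(z)=\sum_j \bigl(C_j\log z_j+C_j'\log z_j'+C_j''\log z_j''\bigr)$ be the log-parameter along $\theta$, with the standard branch of $\log$ on the upper half-plane. Let $U\subseteq\mathbb C$ be open and let $y\colon U\to\mathcal V^+$ be the holomorphic inverse of a coordinate chart of $\mathcal V^+$ given by $u$, i.e. $u(y(w))=w$ for $w\in U$ and $y(U)$ is open in $\mathcal V^+$. (For a homotopically non-trivial simple $\theta$ such a $y$ exists near every point of $\mathcal V^+$; in particular, if $z_*\in\mathcal V^+$ gives the complete structure, then $U$ may be a small neighbourhood of $0$, with $y(0)=z_*$.) Then for every $w\in U$ the tangential gluing complex $$0\to T_wU\xrightarrow{Dy}T_{y(w)}\mathbb C^N_{\operatorname{Im}>0}\xrightarrow{Dg}T_{\mathbf 1}(\mathbb C^*)^N\xrightarrow{Dp}\mathbb C\to0$$ is acyclic, and its torsion $\mathrm{Tor}_1\in\mathbb C^*/\{\pm1\}$ with respect to the bases $\partial/\partial u$; $\partial/\partial z_1,\dots,\partial/\partial z_N$; $\partial/\partial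 x_1,\dots,\partial/\partial x_N$; $1$ is $$\mathrm{Tor}_1=\pm\tfrac12\det\bigl(\hat G\,\mathrm{diag}(\zeta)+\hat G'\,\mathrm{diag}(\zeta')+\hat G''\,\mathrm{diag}(\zeta'')\bigr)\quad\text{at } z=y(w).$$ Here $\hat G,\hat G',\hat G''$ are obtained from $G,G',G''$ by replacing the last row by $C,C',C''$ respectively, and $\zeta_j=1/z_j$, $\zeta_j'=1/(1-z_j)$, $\zeta_j''=1/(z_j(z_j-1))$. The torsion of an acyclic complex $0\to C^0\to C^1\to C^2\to C^3\to0$ with preferred bases $c^i$ is $\pm\prod_{i\text{ even}}\frac{\mathrm{vol}(b^i\cup s^i)}{\mathrm{vol}(c^i)}\prod_{i\text{ odd}}\frac{\mathrm{vol}(c^i)}{\mathrm{vol}(b^i\cup s^i)}$, where $b^i$ is any basis of the space of coboundaries in $C^i$, $s^i$ consists of preimages in $C^i$ of the vectors of $b^{i+1}$, and $\mathrm{vol}(b)/\mathrm{vol}(c)$ is the determinant of the change-of-basis matrix expressing the basis $b$ in terms of the basis $c$. -/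

import Mathlib

/-!
Oriented ideal triangulations, their gluing equations, and the torsion of the tangential
gluing complex.
-/

/-- An oriented ideal triangulation with `N` tetrahedra, given by its face pairings.
The vertices of each tetrahedron are numbered `0, 1, 2, 3` compatibly with the orientation.
The face of the tetrahedron `t` opposite to its vertex `f` is glued to the face of the tetrahedron
`adj t f` opposite to the vertex `perm t f f`; a vertex `a ≠ f` of that face goes to `perm t f a`.
The underlying oriented manifold `M` is the result of the gluing, with the vertices removed. -/
structure IdealTriangulation (N : ℕ) where
  adj : Fin N → Fin 4 → Fin N
  perm : Fin N → Fin 4 → Equiv.Perm (Fin 4)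
  /-- The gluing of a face and the gluing of its partner are inverse to each other. -/
  adj_adj : ∀ t f, adj (adj t f) (perm t f f) = t
  perm_perm : ∀ t f, perm (adj t f) (perm t f f) = (perm t f)⁻¹
  /-- No face is glued to itself. -/
  no_fixed_face : ∀ t f, (adj t f, perm t f f) ≠ (t, f)
  /-- The gluings reverse the induced orientations of the faces. -/
  oriented : ∀ t f, Equiv.Perm.sign (perm t f) = -1

/-- An edge of one of the `N` tetrahedra together with a direction:
`⟨(t, a, b), _⟩` is the edge of the tetrahedron `t` from its vertex `a` to its vertex `b`. -/
abbrev DirEdge (N : ℕ) : Type := {d : Fin N × Fin 4 × Fin 4 // d.2.1 ≠ d.2.2}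

/-- The index `0`, `1` or `2` of the shape parameter `z`, `z'` or `z''` labelling the edge `ab`
of a tetrahedron: `z` labels `01` and `23`, `z'` labels `02` and `13`, `z''` labels `03` and `12`.
(The value at `a = b` is irrelevant.) Seen from any of the four vertices, the parameters
`z, z', z''` of the three edges at that vertex follow in the same cyclic order. -/
def quadIndex (a b : Fin 4) : Fin 3 :=
  if (a = 0 ∧ b = 1) ∨ (a = 1 ∧ b = 0) ∨ (a = 2 ∧ b = 3) ∨ (a = 3 ∧ b = 2) then 0
  else if (a = 0 ∧ b = 2) ∨ (a = 2 ∧ b = 0) ∨ (a = 1 ∧ b = 3) ∨ (a = 3 ∧ b = 1) then 1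
  else 2

/-- The three shape parameters `z`, `z' = 1 / (1 - z)` and `z'' = 1 - 1 / z`. -/
noncomputable def shape (q : Fin 3) (z : ℂ) : ℂ := ![z, 1 / (1 - z), 1 - 1 / z] q

/-- `ζ = 1 / z`, `ζ' = 1 / (1 - z)` and `ζ'' = 1 / (z (z - 1))`. -/
noncomputable def zeta (q : Fin 3) (z : ℂ) : ℂ := ![1 / z, 1 / (1 - z), 1 / (z * (z - 1))] q

namespace IdealTriangulation

variable {N : ℕ} (T : IdealTriangulation N)

/-- The elementary identifications between vertices of tetrahedra: across the face opposite to
`f`. -/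
inductive VertexStep : Fin N × Fin 4 → Fin N × Fin 4 → Prop
  | cross (t : Fin N) (a f : Fin 4) (hf : f ≠ a) :
      VertexStep (t, a) (T.adj t f, T.perm t f a)

/-- The ideal vertices (the ends of `M`): classes of vertices of tetrahedra under the
gluings. -/
def Vertex : Type := Quot T.VertexStep

/-- The ideal vertex represented by the vertex `a` of the tetrahedron `t`. -/
def vertex (t : Fin N) (a : Fin 4) : T.Vertex := Quot.mk _ (t, a)

/-- The elementary identifications between (directed) edges of tetrahedra: forgetting the
direction, and crossing a face that contains the edge. -/
inductive EdgeStep : DirEdge N → DirEdge N → Prop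
  | flip (t : Fin N) (a b : Fin 4) (h : a ≠ b) :
      EdgeStep ⟨(t, a, b), h⟩ ⟨(t, b, a), h.symm⟩
  | cross (t : Fin N) (a b f : Fin 4) (h : a ≠ b) (ha : f ≠ a) (hb : f ≠ b) :
      EdgeStep ⟨(t, a, b), h⟩
        ⟨(T.adj t f, T.perm t f a, T.perm t f b), fun e => h ((T.perm t f).injective e)⟩

/-- The edges of the triangulation: classes of edges of tetrahedra under the gluings. -/
def Edge : Type := Quot T.EdgeStep

/-- The edge of the triangulation represented by an edge of a tetrahedron. -/
def edge (d : DirEdge N) : T.Edge := Quot.mk _ d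

open Classical in
/-- The number `K ∈ {0, 1, 2}` of ends of an edge that are incident to the ideal vertex `v`. -/
noncomputable def endCount (v : T.Vertex) : T.Edge → ℕ :=
  Quot.lift
    (fun d : DirEdge N => (if T.vertex d.1.1 d.1.2.1 = v then 1 else 0) +
      (if T.vertex d.1.1 d.1.2.2 = v then 1 else 0))
    (by
      intro d d' h
      cases h with
      | flip t a b h => exact Nat.add_comm _ _
      | cross t a b f h ha hb =>
        have e1 : T.vertex t a = T.vertex (T.adj t f) (T.perm t f a) :=
          Quot.sound (VertexStep.cross t a f ha)
        have e2 : T.vertex t b = T.vertex (T.adj t f) (T.perm t f b) :=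
          Quot.sound (VertexStep.cross t b f hb)
        simp only [e1, e2])

/-- An oriented closed peripheral curve in normal position, as a cyclic sequence of `len + 1`
segments. The link of the vertex `v` of a tetrahedron `t` is a triangle, with one corner on
each edge `vw` and one side on each face opposite to `f ≠ v`. The segment `(t, σ)` runs in the
link of the vertex `σ 0` of `t`, from the side on the face opposite to `σ 2` to the side on the
face opposite to `σ 3`, and so cuts off the corner on the edge from `σ 0` to `σ 1`.
The next segment, in the tetrahedron behind the face opposite to `σ 3`, begins where it ends;
indices in `Fin (len + 1)` are added cyclically. -/
structure NormalCurve where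
  len : ℕ
  seg : Fin (len + 1) → Fin N × Equiv.Perm (Fin 4)
  adj_seg : ∀ i, (seg (i + 1)).1 = T.adj (seg i).1 ((seg i).2 3)
  vertex_seg : ∀ i, (seg (i + 1)).2 0 = T.perm (seg i).1 ((seg i).2 3) ((seg i).2 0)
  side_seg : ∀ i, (seg (i + 1)).2 2 = T.perm (seg i).1 ((seg i).2 3) ((seg i).2 3)

variable {T} in
/-- The coefficients `C`, `C'`, `C''` (`q = 0, 1, 2`) of the completeness equation along the
curve `θ`: every segment of `θ` which cuts off a corner on an edge of the tetrahedron `j` with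
shape parameter of index `q` contributes `1` if it has the corner on its left and `-1` if it has it
on its right. -/
def NormalCurve.coeff (θ : T.NormalCurve) (q : Fin 3) (j : Fin N) : ℤ :=
  ∑ i, if (θ.seg i).1 = j ∧ quadIndex ((θ.seg i).2 0) ((θ.seg i).2 1) = q
    then -(Equiv.Perm.sign (θ.seg i).2 : ℤ) else 0

variable {T} in
/-- The log-parameter `u = ∑ j, C j log z j + C' j log z' j + C'' j log z'' j` along `θ`. -/
noncomputable def NormalCurve.logParam (θ : T.NormalCurve) (z : Fin N → ℂ) : ℂ :=
  ∑ j, ∑ q, (θ.coeff q j : ℂ) * Complex.log (shape q (z j))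

variable {T}

/-- The gluing matrices `G`, `G'`, `G''` (`q = 0, 1, 2`) with respect to a numbering `e` of the
edges: the `(i, j)` entry is the number of edges of the `j`th tetrahedron which are labelled by the
shape parameter of index `q` and represent the `i`th edge. -/
noncomputable def gluing (e : Fin N ≃ T.Edge) (q : Fin 3) : Matrix (Fin N) (Fin N) ℤ :=
  Matrix.of fun i j => (Nat.card {d : DirEdge N // d.1.1 = j ∧ d.1.2.1 < d.1.2.2 ∧
    quadIndex d.1.2.1 d.1.2.2 = q ∧ T.edge d = e i} : ℤ)

/-- The matrices `Ĝ`, `Ĝ'`, `Ĝ''` (`q = 0, 1, 2`) in the case of one end: the last row of the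
gluing matrix is replaced by the coefficients of the completeness equation along `θ`. -/
noncomputable def gluingHat (e : Fin N ≃ T.Edge) (θ : T.NormalCurve) (q : Fin 3) :
    Matrix (Fin N) (Fin N) ℤ :=
  Matrix.of fun i j => if (i : ℕ) + 1 < N then gluing e q i j else θ.coeff q j

/-- The map `g` whose `i`th component is the product of the shapes about the `i`th edge. -/
noncomputable def gluingMap (e : Fin N ≃ T.Edge) (z : Fin N → ℂ) : Fin N → ℂ :=
  fun i => ∏ j, ∏ q, shape q (z j) ^ gluing e q i j

/-- The positive gluing variety: the positively oriented solutions of the edge equations. -/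
def posVariety (e : Fin N ≃ T.Edge) : Set (Fin N → ℂ) :=
  {z | (∀ j, 0 < (z j).im) ∧ gluingMap e z = 1}

/-- The component of the monomial map `p` at the ideal vertex `v`. -/
noncomputable def vertexMap (e : Fin N ≃ T.Edge) (v : T.Vertex) (x : Fin N → ℂ) : ℂ :=
  ∏ i, x i ^ T.endCount v (e i)

/-- `y : U → 𝒱⁺` is the inverse of a holomorphic coordinate chart of the positive gluing variety
`𝒱⁺` given by the log-parameter along `θ` (for an ideal triangulation with one end): `y` maps the
open set `U ⊆ ℂ` holomorphically onto a relatively open part of `𝒱⁺`, and the log-parameter of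
`y w` is `w`. -/
structure IsInverseChart (e : Fin N ≃ T.Edge) (θ : T.NormalCurve) (U : Set ℂ)
    (y : ℂ → Fin N → ℂ) : Prop where
  isOpen : IsOpen U
  holomorphic : DifferentiableOn ℂ y U
  image_isOpen : ∃ W : Set (Fin N → ℂ), IsOpen W ∧ y '' U = posVariety e ∩ W
  logParam_eq : ∀ w ∈ U, θ.logParam (y w) = w

/-- The matrix `Ĝ diag(ζ) + Ĝ' diag(ζ') + Ĝ'' diag(ζ'')` at the shapes `z`. -/
noncomputable def hatJacobian (e : Fin N ≃ T.Edge) (θ : T.NormalCurve) (z : Fin N → ℂ) :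
    Matrix (Fin N) (Fin N) ℂ :=
  ∑ q, (gluingHat e θ q).map (Int.cast : ℤ → ℂ) * Matrix.diagonal fun j => zeta q (z j)

end IdealTriangulation

section Torsion

variable {F C₀ C₁ C₂ C₃ ι₀ ι₁ ι₂ ι₃ : Type*} [Field F]
  [AddCommGroup C₀] [Module F C₀] [AddCommGroup C₁] [Module F C₁]
  [AddCommGroup C₂] [Module F C₂] [AddCommGroup C₃] [Module F C₃]
  [Fintype ι₀] [DecidableEq ι₀] [Fintype ι₁] [DecidableEq ι₁]
  [Fintype ι₂] [DecidableEq ι₂] [Fintype ι₃] [DecidableEq ι₃]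

/-- The sequence `0 → C₀ → C₁ → C₂ → C₃ → 0` is exact. -/
def IsAcyclicComplex (δ₀ : C₀ →ₗ[F] C₁) (δ₁ : C₁ →ₗ[F] C₂) (δ₂ : C₂ →ₗ[F] C₃) : Prop :=
  Function.Injective δ₀ ∧ Function.Exact δ₀ δ₁ ∧ Function.Exact δ₁ δ₂ ∧ Function.Surjective δ₂

/-- `τ` is one of the two representatives of the torsion in `Fˣ / {±1}` of the acyclic complex
`0 → C₀ → C₁ → C₂ → C₃ → 0` with preferred bases `c₀, c₁, c₂, c₃`. For bases `bᵢ` of the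
coboundaries `Bⁱ` and lifts `sᵢ` of the vectors of `bᵢ₊₁` to `Cᵢ`, it is up to sign the
alternating product of the ratios `vol (bᵢ ∪ sᵢ) / vol cᵢ`, with the even degrees in the numerator.
The equivalences `eᵢ` order the families `bᵢ ∪ sᵢ`. -/
def IsTorsion (δ₀ : C₀ →ₗ[F] C₁) (δ₁ : C₁ →ₗ[F] C₂) (δ₂ : C₂ →ₗ[F] C₃)
    (c₀ : Module.Basis ι₀ F C₀) (c₁ : Module.Basis ι₁ F C₁)
    (c₂ : Module.Basis ι₂ F C₂) (c₃ : Module.Basis ι₃ F C₃) (τ : F) : Prop :=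
  IsAcyclicComplex δ₀ δ₁ δ₂ ∧
  ∃ (m₁ m₂ m₃ : ℕ)
    (b₁ : Module.Basis (Fin m₁) F (LinearMap.range δ₀))
    (b₂ : Module.Basis (Fin m₂) F (LinearMap.range δ₁))
    (b₃ : Module.Basis (Fin m₃) F (LinearMap.range δ₂))
    (s₀ : Fin m₁ → C₀) (s₁ : Fin m₂ → C₁) (s₂ : Fin m₃ → C₂)
    (e₀ : ι₀ ≃ Fin m₁) (e₁ : ι₁ ≃ Fin m₁ ⊕ Fin m₂) (e₂ : ι₂ ≃ Fin m₂ ⊕ Fin m₃)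
    (e₃ : ι₃ ≃ Fin m₃) (ε : ℤˣ),
    (∀ r, δ₀ (s₀ r) = b₁ r) ∧ (∀ r, δ₁ (s₁ r) = b₂ r) ∧ (∀ r, δ₂ (s₂ r) = b₃ r) ∧
    τ = ((ε : ℤ) : F) *
      ((c₀.det (s₀ ∘ e₀) * c₂.det (Sum.elim (fun r => (b₂ r : C₂)) s₂ ∘ e₂)) /
        (c₁.det (Sum.elim (fun r => (b₁ r : C₁)) s₁ ∘ e₁) *
          c₃.det ((fun r => (b₃ r : C₃)) ∘ e₃)))

end Torsion

/-!
The idea of the proof. On the product of upper half-planes the gluing map is `g = exp h`, where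
`h i = ∑ j, ∑ q, G q i j * log (shape q (z j))`, so that at a point of the positive gluing variety
`Dg` is the Jacobian `J = ∑ q, G q * diag (zeta q)` of `h`.

*Acyclicity.* The main point is that every vector of `ker J` is tangent to the curve `y`. It follows
from two facts.

* The rows of the gluing matrices are isotropic for the symplectic form of Neumann and Zagier
  (`sum_symplectic_gluing`): the form counts with signs the pairs of edges in a common face of a
  tetrahedron, and an orientation-reversing face pairing matches these with opposite signs.
* On the tangent space of the product of upper half-planes, `X ↦ i ω(X, conj X)` is definite
  (`exists_symplectic_conj_eq`).

Hence a linear relation among the rows of `J` at a single point forces the three corresponding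
combinations of `G 0`, `G 1`, `G 2` to coincide (`sum_mul_gluing_eq`), and since
`log z + log z' + log z'' = π i`, the same relation then makes a combination of the components of
`h` constant. So `h` takes its values in an affine space over `range J`, the implicit
function theorem applies to `h` as a map to that space, and every vector of `ker J` is the velocity of a
curve `γ` in the positive gluing variety (`HasStrictFDerivAt.exists_curve_of_sub_mem_range`).
Near `y w` this variety is the image of `y`, so `γ = y ∘ u ∘ γ`, and the vector is in the range of
`Dy` (`IsInverseChart.exists_fderiv_eq`). The injectivity of `Dy` is the chain rule for
`u (y w) = w`. As each tetrahedron has two edges of each label and `zeta 0 + zeta 1 + zeta 2 = 0`,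
the columns of `J` have sum zero, and `Dp` is twice the sum of the coordinates because each edge has
both ends at the only ideal vertex; so `Dp ∘ Dg = 0`, and exactness at `Dg, Dp` is a count of
dimensions.

*Torsion.* Let `b₁ ∪ s₁` and `b₂ ∪ s₂` be the bases in degrees `1` and `2`. The matrix `Ĵ`, which is
`J` with last row replaced by `Du`, sends `b₁` to a multiple of the last unit vector and `s₁` to
`b₂` up to the last coordinate. Replacing the last coordinate by the sum of all coordinates, which
has determinant `1`, kills the last coordinate of `b₂` and makes that of `s₂` equal to `Dp s₂ / 2`.
The two resulting matrices have a common minor, and its comparison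
(`Matrix.mul_det_eq_mul_det`) gives `± det Ĵ / 2`.
-/

/-! ### Gluing matrices and their symplectic relations -/

namespace IdealTriangulation

variable {N : ℕ} {T : IdealTriangulation N}

open Classical in
/-- The indicator that the vertices `a`, `b` of the tetrahedron `t` are distinct and span an edge
representing the `i`th edge of the triangulation. -/
noncomputable def edgeIndicator (e : Fin N ≃ T.Edge) (i t : Fin N) (a b : Fin 4) : ℤ :=
  if ∃ h : a ≠ b, T.edge ⟨(t, a, b), h⟩ = e i then 1 else 0

theorem edgeIndicator_comm (e : Fin N ≃ T.Edge) (i t : Fin N) (a b : Fin 4) :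
    edgeIndicator e i t a b = edgeIndicator e i t b a := by
  have key (h : a ≠ b) : T.edge ⟨(t, a, b), h⟩ = T.edge ⟨(t, b, a), h.symm⟩ :=
    Quot.sound (EdgeStep.flip t a b h)
  unfold edgeIndicator
  congr 1
  exact propext ⟨fun ⟨h, h'⟩ => ⟨h.symm, key h ▸ h'⟩,
    fun ⟨h, h'⟩ => ⟨h.symm, (key h.symm).trans h'⟩⟩

theorem edgeIndicator_cross (e : Fin N ≃ T.Edge) (i t : Fin N) {a b f : Fin 4}
    (ha : f ≠ a) (hb : f ≠ b) :
    edgeIndicator e i (T.adj t f) (T.perm t f a) (T.perm t f b) = edgeIndicator e i t a b := by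
  unfold edgeIndicator
  congr 1
  refine propext ⟨fun ⟨h, h'⟩ => ?_, fun ⟨h, h'⟩ => ?_⟩
  · have hab : a ≠ b := fun hab => h (congrArg _ hab)
    exact ⟨hab, (Quot.sound (EdgeStep.cross t a b f hab ha hb)).trans h'⟩
  · exact ⟨fun hab => h ((T.perm t f).injective hab),
      (Quot.sound (EdgeStep.cross t a b f h ha hb)).symm.trans h'⟩

theorem gluing_eq_sum (e : Fin N ≃ T.Edge) (q : Fin 3) (i j : Fin N) :
    gluing e q i j =
      ∑ a, ∑ b, if a < b ∧ quadIndex a b = q then edgeIndicator e i j a b else 0 := by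
  classical
  let f : {d : DirEdge N // d.1.1 = j ∧ d.1.2.1 < d.1.2.2 ∧
      quadIndex d.1.2.1 d.1.2.2 = q ∧ T.edge d = e i} ≃
      {p : Fin 4 × Fin 4 // (p.1 < p.2 ∧ quadIndex p.1 p.2 = q) ∧
        ∃ h : p.1 ≠ p.2, T.edge ⟨(j, p.1, p.2), h⟩ = e i} :=
    { toFun := fun d => ⟨d.1.1.2, ⟨d.2.2.1, d.2.2.2.1⟩, d.1.2, by
        obtain ⟨⟨⟨t, a, b⟩, h⟩, rfl, h2, h3, h4⟩ := d
        exact h4⟩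
      invFun := fun p => ⟨⟨(j, p.1.1, p.1.2), p.2.2.1⟩, rfl, p.2.1.1, p.2.1.2, p.2.2.2⟩
      left_inv := by
        rintro ⟨⟨⟨t, a, b⟩, h⟩, rfl, h2, h3, h4⟩
        rfl
      right_inv := fun p => rfl }
  rw [gluing, Matrix.of_apply, Nat.card_congr f, Nat.card_eq_fintype_card, Fintype.card_subtype,
    Finset.card_filter, Fintype.sum_prod_type]
  push_cast
  simp only [edgeIndicator, ite_and]

theorem gluing_zero (e : Fin N ≃ T.Edge) (i j : Fin N) :
    gluing e 0 i j = edgeIndicator e i j 0 1 + edgeIndicator e i j 2 3 := by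
  simp [gluing_eq_sum, Fin.sum_univ_four, quadIndex]

theorem gluing_one (e : Fin N ≃ T.Edge) (i j : Fin N) :
    gluing e 1 i j = edgeIndicator e i j 0 2 + edgeIndicator e i j 1 3 := by
  simp [gluing_eq_sum, Fin.sum_univ_four, quadIndex]

theorem gluing_two (e : Fin N ≃ T.Edge) (i j : Fin N) :
    gluing e 2 i j = edgeIndicator e i j 0 3 + edgeIndicator e i j 1 2 := by
  simp [gluing_eq_sum, Fin.sum_univ_four, quadIndex]

theorem sum_edgeIndicator (e : Fin N ≃ T.Edge) (t : Fin N) {a b : Fin 4} (h : a ≠ b) :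
    ∑ i, edgeIndicator e i t a b = 1 := by
  classical
  have key (i : Fin N) : edgeIndicator e i t a b =
      if i = e.symm (T.edge ⟨(t, a, b), h⟩) then 1 else 0 := by
    unfold edgeIndicator
    congr 1
    simp only [h, ne_eq, not_false_eq_true, exists_true_left, Equiv.eq_symm_apply, eq_comm]
  simp [key]

/-- Each tetrahedron has two edges with a given label. -/
theorem sum_gluing (e : Fin N ≃ T.Edge) (q : Fin 3) (j : Fin N) : ∑ i, gluing e q i j = 2 := by
  fin_cases q <;>
    simp [gluing_zero, gluing_one, gluing_two, Finset.sum_add_distrib, sum_edgeIndicator]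

/-- The Neumann-Zagier form of the rows `i` and `k`, restricted to the tetrahedron `t`, is a signed
count of the pairs of edges of `t` at a common vertex that represent the edges `i` and `k`. An
ordered pair of such edges is `σ 0 σ 1`, `σ 0 σ 2` for a unique permutation `σ`, with sign telling
whether the label of the second edge follows that of the first. -/
theorem sum_perm_edgeIndicator (e : Fin N ≃ T.Edge) (i k t : Fin N) :
    ∑ σ : Equiv.Perm (Fin 4), (Equiv.Perm.sign σ : ℤ) *
        (edgeIndicator e i t (σ 0) (σ 1) * edgeIndicator e k t (σ 0) (σ 2)) =
      ∑ q, (gluing e q i t * gluing e (q + 1) k t - gluing e (q + 1) i t * gluing e q k t) := by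
  -- The summands with `σ 0 = a` form the Leibniz expansion of the determinant of `M a`.
  let M (a : Fin 4) : Matrix (Fin 4) (Fin 4) ℤ := Matrix.of fun r c =>
    ![Pi.single a 1, edgeIndicator e i t a, edgeIndicator e k t a, 1] c r
  have key (σ : Equiv.Perm (Fin 4)) : (Equiv.Perm.sign σ : ℤ) *
        (edgeIndicator e i t (σ 0) (σ 1) * edgeIndicator e k t (σ 0) (σ 2)) =
      ∑ a, (Equiv.Perm.sign σ : ℤ) * ∏ c, M a (σ c) c := by
    rw [Finset.sum_eq_single (σ 0)]
    · simp [M, Fin.prod_univ_four]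
    · intro a _ ha
      simp [M, Fin.prod_univ_four, Pi.single_apply, ha.symm]
    · simp
  have hc := edgeIndicator_comm e i t
  have hd := edgeIndicator_comm e k t
  rw [Finset.sum_congr rfl fun σ _ => key σ, Finset.sum_comm]
  have hdet (a : Fin 4) : ∑ σ : Equiv.Perm (Fin 4), (Equiv.Perm.sign σ : ℤ) * ∏ c, M a (σ c) c =
    (M a).det := (Matrix.det_apply' _).symm
  rw [Finset.sum_congr rfl fun a _ => hdet a]
  simp only [Matrix.det_succ_column_zero, Fin.sum_univ_four, Fin.sum_univ_three]
  simp [M, Fin.succAbove, Pi.single_apply, gluing_zero, gluing_one, gluing_two]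
  rw [hc 1 0, hc 2 0, hc 3 0, hc 2 1, hc 3 1, hc 3 2,
    hd 1 0, hd 2 0, hd 3 0, hd 2 1, hd 3 1, hd 3 2]
  ring

/-- The Neumann-Zagier relations: the rows of the gluing matrices are isotropic. Two edges with a
common vertex lie in a common face; crossing this face is an involution on such configurations that
reverses the sign. -/
theorem sum_symplectic_gluing (e : Fin N ≃ T.Edge) (i k : Fin N) :
    ∑ j, ∑ q, (gluing e q i j * gluing e (q + 1) k j - gluing e (q + 1) i j * gluing e q k j) =
      0 := by
  simp_rw [← sum_perm_edgeIndicator]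
  rw [← Fintype.sum_prod_type' (f := fun (t : Fin N) (σ : Equiv.Perm (Fin 4)) =>
    (Equiv.Perm.sign σ : ℤ) *
      (edgeIndicator e i t (σ 0) (σ 1) * edgeIndicator e k t (σ 0) (σ 2)))]
  let cross : Fin N × Equiv.Perm (Fin 4) → Fin N × Equiv.Perm (Fin 4) :=
    fun p => (T.adj p.1 (p.2 3), T.perm p.1 (p.2 3) * p.2)
  refine Finset.sum_ninvolution cross (fun p => ?_) (fun p _ hp => ?_) (fun p => Finset.mem_univ _)
    (fun p => ?_)
  · simp only [cross, Equiv.Perm.sign_mul, T.oriented, Equiv.Perm.coe_mul, Function.comp_apply]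
    rw [edgeIndicator_cross, edgeIndicator_cross]
    · push_cast
      ring
    all_goals exact p.2.injective.ne (by decide)
  · refine T.no_fixed_face p.1 (p.2 3) (Prod.ext (congrArg Prod.fst hp :) ?_)
    exact congrArg (fun p => p.2 3) hp
  · simp [cross, T.adj_adj, T.perm_perm]

end IdealTriangulation

/-! ### Shape parameters in the upper half-plane -/

theorem shape_im_pos (q : Fin 3) {z : ℂ} (hz : 0 < z.im) : 0 < (shape q z).im := by
  have h1 : 0 < Complex.normSq (1 - z) :=
    Complex.normSq_pos.2 fun h => by simpa [hz.ne'] using congrArg Complex.im h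
  have h0 : 0 < Complex.normSq z :=
    Complex.normSq_pos.2 fun h => by simpa [hz.ne'] using congrArg Complex.im h
  fin_cases q
  · simpa [shape] using hz
  · simpa [shape, Complex.inv_im] using div_pos hz h1
  · simpa [shape, Complex.inv_im, neg_div] using div_pos hz h0

theorem shape_ne_zero (q : Fin 3) {z : ℂ} (hz : 0 < z.im) : shape q z ≠ 0 := fun h => by
  simpa [h] using shape_im_pos q hz

theorem hasStrictDerivAt_log_shape (q : Fin 3) {z : ℂ} (hz : 0 < z.im) :
    HasStrictDerivAt (fun z => Complex.log (shape q z)) (zeta q z) z := by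
  have h0 : z ≠ 0 := fun h => by simp [h] at hz
  have h1 : 1 - z ≠ 0 := fun h => by simpa [hz.ne'] using congrArg Complex.im h
  have h2 : z - 1 ≠ 0 := fun h => by simpa [hz.ne'] using congrArg Complex.im h
  have hs : shape q z ∈ Complex.slitPlane := Or.inr (shape_im_pos q hz).ne'
  have hs0 := shape_ne_zero q hz
  have hid := hasStrictDerivAt_id z
  fin_cases q
  · simpa [shape, zeta] using hid.clog hs
  · convert (((hasStrictDerivAt_inv h1).comp z (hid.const_sub 1)).clog
      (by simpa [shape] using hs)) using 1
    · simp [shape]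
    · simp [zeta]
      field_simp
  · convert (((hasStrictDerivAt_inv h0).const_sub 1).clog (by simpa [shape] using hs)) using 1
    · simp [shape]
    · have h3 : 1 - z⁻¹ ≠ 0 := by simpa [shape] using hs0
      simp only [zeta]
      simp
      field_simp

theorem sum_zeta {z : ℂ} (hz : 0 < z.im) : ∑ q, zeta q z = 0 := by
  have h0 : z ≠ 0 := fun h => by simp [h] at hz
  have h1 : 1 - z ≠ 0 := fun h => by simpa [hz.ne'] using congrArg Complex.im h
  have h2 : z - 1 ≠ 0 := fun h => by simpa [hz.ne'] using congrArg Complex.im h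
  simp only [zeta, Fin.sum_univ_three, Matrix.cons_val]
  field_simp
  ring

/-- The dihedral angles of an ideal tetrahedron at a vertex have sum `π`. -/
theorem sum_log_shape {z : ℂ} (hz : 0 < z.im) :
    ∑ q, Complex.log (shape q z) = Real.pi * Complex.I := by
  have h0 : z ≠ 0 := fun h => by simp [h] at hz
  have h1 : 1 - z ≠ 0 := fun h => by simpa [hz.ne'] using congrArg Complex.im h
  have harg (q : Fin 3) : 0 < (shape q z).arg ∧ (shape q z).arg < Real.pi := by
    have h := shape_im_pos q hz
    refine ⟨(Complex.arg_nonneg_iff.2 h.le).lt_of_ne' fun h' => ?_,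
      (Complex.arg_le_pi _).lt_of_ne fun h' => ?_⟩
    · exact h.ne' (Complex.arg_eq_zero_iff.1 h').2
    · exact h.ne' (Complex.arg_eq_pi_iff.1 h').2
  -- The product of the three shapes is `-1`; as the three arguments lie between `0` and `π`, the
  -- imaginary part of the sum of the logarithms can only be `π`.
  have hexp : Complex.exp (∑ q, Complex.log (shape q z)) = Complex.exp (Real.pi * Complex.I) := by
    rw [Complex.exp_sum, Complex.exp_pi_mul_I]
    simp_rw [Complex.exp_log (shape_ne_zero _ hz)]
    simp only [shape, Fin.prod_univ_three, Matrix.cons_val]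
    field_simp
    ring
  obtain ⟨n, hn⟩ := Complex.exp_eq_exp_iff_exists_int.1 hexp
  have him : (shape 0 z).arg + (shape 1 z).arg + (shape 2 z).arg = Real.pi + n * (2 * Real.pi) := by
    simpa [Fin.sum_univ_three, Complex.log_im] using congrArg Complex.im hn
  have hpi := Real.pi_pos
  have hn1 : (n : ℝ) < 1 := by nlinarith [harg 0, harg 1, harg 2]
  have hn0 : (-1 : ℝ) < n := by nlinarith [harg 0, harg 1, harg 2]
  have : n = 0 := by
    have h1 : n < 1 := by exact_mod_cast hn1
    have h2 : -1 < n := by exact_mod_cast hn0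
    omega
  simpa [this] using hn

open ComplexConjugate in
/-- The vectors `X` orthogonal to `(zeta q z)` form, modulo the constant vectors, a line on which
the Hermitian form induced by the symplectic form is definite: with `u = z / (1 - z)` they satisfy
`X 0 - X 2 = -u (X 1 - X 2)`, and `Im u > 0`. -/
theorem exists_symplectic_conj_eq {z : ℂ} (hz : 0 < z.im) :
    ∃ r : ℝ, 0 < r ∧ ∀ X : Fin 3 → ℂ, ∑ q, X q * zeta q z = 0 →
      (∑ q, (X q * conj (X (q + 1)) - X (q + 1) * conj (X q)) =
        -Complex.I * ((r * Complex.normSq (X 1 - X 2) : ℝ) : ℂ)) ∧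
      (X 1 = X 2 → ∀ q, X q = X 0) := by
  have h0 : z ≠ 0 := fun h => by simp [h] at hz
  have h1 : 1 - z ≠ 0 := fun h => by simpa [hz.ne'] using congrArg Complex.im h
  have h2 : z - 1 ≠ 0 := fun h => by simpa [hz.ne'] using congrArg Complex.im h
  set u : ℂ := z / (1 - z) with hu
  have hu' : u = (1 - z)⁻¹ - 1 := by
    rw [hu]
    field_simp
    ring
  have huim : 0 < u.im := by
    rw [hu']
    simpa [Complex.inv_im] using div_pos hz (Complex.normSq_pos.2 h1)
  refine ⟨2 * u.im, by positivity, fun X hX => ?_⟩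
  have key : X 0 - X 2 = -u * (X 1 - X 2) := by
    have hsum := sum_zeta hz
    simp only [Fin.sum_univ_three] at hX hsum
    have : (X 0 - X 2) * zeta 0 z + (X 1 - X 2) * zeta 1 z = 0 := by
      linear_combination hX - X 2 * hsum
    simp only [zeta, Matrix.cons_val] at this
    rw [hu]
    field_simp at this ⊢
    linear_combination this
  constructor
  · have hconj : u - conj u = 2 * u.im * Complex.I := by
      rw [Complex.sub_conj]
      push_cast
      ring
    have key' := congrArg conj key
    simp only [map_sub, map_mul, map_neg] at key'
    have hns : ((Complex.normSq (X 1 - X 2) : ℝ) : ℂ) =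
        (X 1 - X 2) * (conj (X 1) - conj (X 2)) := by
      rw [← map_sub, Complex.mul_conj]
    have e1 : (0 + 1 : Fin 3) = 1 := rfl
    have e2 : (1 + 1 : Fin 3) = 2 := rfl
    have e3 : (2 + 1 : Fin 3) = 0 := rfl
    simp only [Fin.sum_univ_three, e1, e2, e3, Complex.ofReal_mul, hns, Complex.ofReal_ofNat]
    linear_combination (conj (X 1) - conj (X 2)) * key - (X 1 - X 2) * key' -
      (X 1 - X 2) * (conj (X 1) - conj (X 2)) * hconj
  · intro h
    rw [h, sub_self, mul_zero, sub_eq_zero] at key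
    intro q
    fin_cases q
    · rfl
    · exact h.trans key.symm
    · exact key.symm

/-! ### The logarithmic gluing map -/

section LogForm

variable {N : ℕ}

/-- The integral combination `∑ j, ∑ q, c q j log (shape q (z j))` of logarithms of shapes. Both the
log-parameter along a curve and the logarithms of the edge products have this form. -/
noncomputable def logForm (c : Fin 3 → Fin N → ℤ) (z : Fin N → ℂ) : ℂ :=
  ∑ j, ∑ q, (c q j : ℂ) * Complex.log (shape q (z j))

/-- The partial derivatives of `logForm c`. -/
noncomputable def logFormGradient (c : Fin 3 → Fin N → ℤ) (z : Fin N → ℂ) (j : Fin N) : ℂ :=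
  ∑ q, (c q j : ℂ) * zeta q (z j)

theorem hasStrictFDerivAt_logForm (c : Fin 3 → Fin N → ℤ) {z : Fin N → ℂ}
    (hz : ∀ j, 0 < (z j).im) :
    HasStrictFDerivAt (logForm c)
      (∑ j, logFormGradient c z j • ContinuousLinearMap.proj (R := ℂ) (φ := fun _ => ℂ) j) z := by
  refine HasStrictFDerivAt.fun_sum fun j _ => ?_
  have h : HasStrictDerivAt (fun x => ∑ q, (c q j : ℂ) * Complex.log (shape q x))
      (logFormGradient c z j) (z j) :=
    HasStrictDerivAt.fun_sum fun q _ => (hasStrictDerivAt_log_shape q (hz j)).const_mul _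
  exact h.comp_hasStrictFDerivAt z
    (ContinuousLinearMap.proj (R := ℂ) (φ := fun _ : Fin N => ℂ) j).hasStrictFDerivAt

end LogForm

namespace IdealTriangulation

variable {N : ℕ} {T : IdealTriangulation N}

/-- The logarithmic gluing map, with the standard branch of each logarithm; its exponential is the
gluing map on the product of upper half-planes. -/
noncomputable def logGluingMap (e : Fin N ≃ T.Edge) (z : Fin N → ℂ) : Fin N → ℂ :=
  fun i => logForm (fun q => gluing e q i) z

/-- The Jacobian matrix `∑ q, G q * diag (zeta q)` of the logarithmic gluing map. -/
noncomputable def gluingJacobian (e : Fin N ≃ T.Edge) (z : Fin N → ℂ) :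
    Matrix (Fin N) (Fin N) ℂ :=
  Matrix.of fun i => logFormGradient (fun q => gluing e q i) z

theorem hasStrictFDerivAt_logGluingMap (e : Fin N ≃ T.Edge) {z : Fin N → ℂ}
    (hz : ∀ j, 0 < (z j).im) :
    HasStrictFDerivAt (logGluingMap e) (gluingJacobian e z).mulVecLin.toContinuousLinearMap z := by
  refine hasStrictFDerivAt_pi'.2 fun i => ?_
  refine (hasStrictFDerivAt_logForm (fun q => gluing e q i) hz).congr_fderiv ?_
  ext x
  simp [gluingJacobian, Matrix.mulVec, dotProduct]

theorem exp_logGluingMap (e : Fin N ≃ T.Edge) {z : Fin N → ℂ} (hz : ∀ j, 0 < (z j).im)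
    (i : Fin N) : Complex.exp (logGluingMap e z i) = gluingMap e z i := by
  simp only [logGluingMap, logForm, gluingMap, Complex.exp_sum, Complex.exp_int_mul,
    Complex.exp_log (shape_ne_zero _ (hz _))]

theorem isOpen_upperHalfSpace : IsOpen {z : Fin N → ℂ | ∀ j, 0 < (z j).im} := by
  simp only [Set.ofPred_forall]
  exact isOpen_iInter_of_finite fun j =>
    isOpen_lt continuous_const (Complex.continuous_im.comp (continuous_apply j))

/-- On the positive gluing variety the logarithmic derivative of the gluing map is its derivative,
since its value is `1`. -/
theorem hasFDerivAt_gluingMap (e : Fin N ≃ T.Edge) {z : Fin N → ℂ} (hz : z ∈ posVariety e) :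
    HasFDerivAt (gluingMap e) (gluingJacobian e z).mulVecLin.toContinuousLinearMap z := by
  have h := (hasStrictFDerivAt_logGluingMap e hz.1).hasFDerivAt
  refine hasFDerivAt_pi'.2 fun i => ?_
  have hi := (hasFDerivAt_pi'.1 h i).cexp
  rw [exp_logGluingMap e hz.1, hz.2, Pi.one_apply, one_smul] at hi
  refine hi.congr_of_eventuallyEq ?_
  filter_upwards [isOpen_upperHalfSpace.mem_nhds hz.1] with x hx using
    (exp_logGluingMap e hx i).symm

theorem sum_gluingJacobian (e : Fin N ≃ T.Edge) {z : Fin N → ℂ} (hz : ∀ j, 0 < (z j).im)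
    (j : Fin N) : ∑ i, gluingJacobian e z i j = 0 := by
  simp only [gluingJacobian, Matrix.of_apply, logFormGradient]
  rw [Finset.sum_comm]
  simp_rw [← Finset.sum_mul, ← Int.cast_sum, sum_gluing, ← Finset.mul_sum]
  rw [sum_zeta (hz j), mul_zero]

open ComplexConjugate in
/-- A linear relation among the rows of the Jacobian at one point of the product of upper
half-planes comes from a combination of edge equations in which `z j`, `z' j`, `z'' j` have the same
coefficient for each `j`. Indeed the coefficient vector is isotropic by the Neumann-Zagier
relations, while the form is definite at each tetrahedron. -/
theorem sum_mul_gluing_eq (e : Fin N ≃ T.Edge) {z : Fin N → ℂ} (hz : ∀ j, 0 < (z j).im)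
    {l : Fin N → ℂ} (hl : ∀ j, ∑ i, l i * gluingJacobian e z i j = 0) (q : Fin 3) (j : Fin N) :
    ∑ i, l i * gluing e q i j = ∑ i, l i * gluing e 0 i j := by
  set X : Fin N → Fin 3 → ℂ := fun j q => ∑ i, l i * gluing e q i j with hX
  have hX0 (j : Fin N) : ∑ q, X j q * zeta q (z j) = 0 := by
    rw [← hl j]
    simp only [hX, gluingJacobian, Matrix.of_apply, logFormGradient, Finset.sum_mul,
      Finset.mul_sum]
    rw [Finset.sum_comm]
    simp only [mul_assoc]
  choose r hr hS using fun j => exists_symplectic_conj_eq (hz j)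
  have hcyc : ∑ j, ∑ q, (X j q * conj (X j (q + 1)) - X j (q + 1) * conj (X j q)) = 0 := by
    have key (j : Fin N) : ∑ q, (X j q * conj (X j (q + 1)) - X j (q + 1) * conj (X j q)) =
        ∑ i, ∑ k, l i * conj (l k) * ((∑ q, (gluing e q i j * gluing e (q + 1) k j -
          gluing e (q + 1) i j * gluing e q k j) : ℤ) : ℂ) := by
      have hprod (a b : Fin N → ℤ) : (∑ i, l i * (a i : ℂ)) * conj (∑ i, l i * (b i : ℂ)) =
          ∑ i, ∑ k, l i * conj (l k) * ((a i : ℂ) * (b k : ℂ)) := by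
        simp only [map_sum, map_mul, map_intCast, Finset.sum_mul_sum]
        refine Finset.sum_congr rfl fun i _ => Finset.sum_congr rfl fun k _ => ?_
        ring
      have hX' (q q' : Fin 3) : X j q * conj (X j q') = ∑ i, ∑ k, l i * conj (l k) *
          ((gluing e q i j : ℂ) * (gluing e q' k j : ℂ)) := hprod _ _
      simp only [hX', ← Finset.sum_sub_distrib, ← mul_sub, Int.cast_sum, Int.cast_sub,
        Int.cast_mul, Finset.mul_sum]
      rw [Finset.sum_comm]
      exact Finset.sum_congr rfl fun i _ => Finset.sum_comm
    rw [Finset.sum_congr rfl fun j _ => key j, Finset.sum_comm]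
    refine Finset.sum_eq_zero fun i _ => ?_
    rw [Finset.sum_comm]
    refine Finset.sum_eq_zero fun k _ => ?_
    rw [← Finset.mul_sum, ← Int.cast_sum, sum_symplectic_gluing, Int.cast_zero, mul_zero]
  rw [Finset.sum_congr rfl fun j _ => (hS j (X j) (hX0 j)).1, ← Finset.mul_sum,
    ← Complex.ofReal_sum, mul_eq_zero, or_iff_right (neg_ne_zero.2 Complex.I_ne_zero),
    Complex.ofReal_eq_zero, Finset.sum_eq_zero_iff_of_nonneg fun j _ =>
      mul_nonneg (hr j).le (Complex.normSq_nonneg _)] at hcyc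
  refine (hS j (X j) (hX0 j)).2 ?_ q
  simpa [(hr j).ne', sub_eq_zero] using hcyc j (Finset.mem_univ j)

/-- A linear relation among the rows of the Jacobian at `z` makes the same combination of the
components of the logarithmic gluing map constant. -/
theorem sum_mul_logGluingMap (e : Fin N ≃ T.Edge) {z x : Fin N → ℂ} (hz : ∀ j, 0 < (z j).im)
    (hx : ∀ j, 0 < (x j).im) {l : Fin N → ℂ}
    (hl : ∀ j, ∑ i, l i * gluingJacobian e z i j = 0) :
    ∑ i, l i * logGluingMap e x i = ∑ j, (∑ i, l i * gluing e 0 i j) * (Real.pi * Complex.I) := by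
  simp only [logGluingMap, logForm, Finset.mul_sum]
  rw [Finset.sum_comm]
  refine Finset.sum_congr rfl fun j _ => ?_
  rw [Finset.sum_comm, ← sum_log_shape (hx j), Finset.mul_sum]
  refine Finset.sum_congr rfl fun q _ => ?_
  rw [← sum_mul_gluing_eq e hz hl q j, Finset.sum_mul]
  simp only [mul_assoc]

/-- The logarithmic gluing map takes its values in an affine space over the range of its derivative
at any given point. -/
theorem logGluingMap_sub_mem_range (e : Fin N ≃ T.Edge) {z x : Fin N → ℂ}
    (hz : ∀ j, 0 < (z j).im) (hx : ∀ j, 0 < (x j).im) :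
    logGluingMap e x - logGluingMap e z ∈ LinearMap.range (gluingJacobian e z).mulVecLin := by
  by_contra hmem
  obtain ⟨f, hf, hle⟩ := Submodule.exists_le_ker_of_notMem hmem
  have hf' (v : Fin N → ℂ) : f v = ∑ i, f (Pi.single i 1) * v i := by
    rw [LinearMap.pi_apply_eq_sum_univ f v]
    refine Finset.sum_congr rfl fun i _ => ?_
    rw [smul_eq_mul, mul_comm]
    congr 2
    ext k
    simp [Pi.single_apply, eq_comm]
  have hl (j : Fin N) : ∑ i, f (Pi.single i 1) * gluingJacobian e z i j = 0 := by
    have h := hle ⟨Pi.single j 1, rfl⟩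
    rw [LinearMap.mem_ker, hf'] at h
    simpa using h
  refine hf ?_
  rw [map_sub, hf' (logGluingMap e x), hf' (logGluingMap e z), sum_mul_logGluingMap e hz hx hl,
    sum_mul_logGluingMap e hz hz hl, sub_self]

end IdealTriangulation

/-! ### Tangent vectors of the positive gluing variety -/

/-- If near `a` the values of `f` lie in an affine space over the range of its derivative at `a`,
then every vector of the kernel of the derivative is the velocity of a curve in the fibre of `f`
through `a`. -/
theorem HasStrictFDerivAt.exists_curve_of_sub_mem_range {𝕜 E F : Type*}
    [RCLike 𝕜] [NormedAddCommGroup E] [NormedSpace 𝕜 E] [CompleteSpace E]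
    [NormedAddCommGroup F] [NormedSpace 𝕜 F] [FiniteDimensional 𝕜 F] {f : E → F} {f' : E →L[𝕜] F}
    {a : E} (hf : HasStrictFDerivAt f f' a) (hr : ∀ᶠ x in nhds a, f x - f a ∈ f'.range)
    {v : E} (hv : f' v = 0) :
    ∃ γ : 𝕜 → E, γ 0 = a ∧ HasDerivAt γ v 0 ∧ ∀ᶠ t in nhds 0, f (γ t) = f a := by
  obtain ⟨π, hπ⟩ := Submodule.ClosedComplemented.of_finiteDimensional f'.range
  -- Composed with a projection to the range of `f'`, the map becomes a submersion, and on the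
  -- affine space containing the values of `f` near `a` the projection is injective.
  have hg : HasStrictFDerivAt (fun x => π (f x)) (π ∘L f') a :=
    π.hasStrictFDerivAt.comp a hf
  have hsurj : (π ∘L f').range = ⊤ := by
    refine LinearMap.range_eq_top.2 fun y => ?_
    obtain ⟨x, hx⟩ := y.2
    exact ⟨x, (congrArg π hx).trans (hπ y)⟩
  let v' : (π ∘L f').ker := ⟨v, by simp [hv]⟩
  have hv'0 : (0 : 𝕜) • v' = 0 := zero_smul 𝕜 v'
  have hline : HasDerivAt (fun t : 𝕜 => t • v') v' 0 :=
    ((hasDerivAt_id (0 : 𝕜)).smul_const v').congr_deriv (one_smul 𝕜 v')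
  have hline0 : Filter.Tendsto (fun t : 𝕜 => t • v') (nhds 0) (nhds 0) :=
    hv'0 ▸ hline.continuousAt.tendsto
  set γ : 𝕜 → E := fun t => hg.implicitFunction _ _ hsurj (π (f a)) (t • v') with hγ
  have h0 : γ 0 = a :=
    (congrArg _ hv'0).trans (hg.implicitFunction_apply_image hsurj)
  have hd : HasDerivAt γ v 0 := by
    have h := (hg.to_implicitFunction hsurj).hasFDerivAt
    rw [← hv'0] at h
    exact h.comp_hasDerivAt (0 : 𝕜) hline
  refine ⟨γ, h0, hd, ?_⟩
  have hγa : Filter.Tendsto γ (nhds 0) (nhds a) := by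
    simpa [h0] using hd.continuousAt.tendsto
  have hmap : ∀ᶠ t in nhds (0 : 𝕜), π (f (γ t)) = π (f a) :=
    (tendsto_const_nhds.prodMk_nhds hline0).eventually (hg.map_implicitFunction_eq hsurj)
  filter_upwards [hmap, hγa.eventually hr] with t ht hrt
  have h := hπ ⟨_, hrt⟩
  rw [map_sub, ht, sub_self] at h
  exact sub_eq_zero.1 (congrArg Subtype.val h).symm

namespace IdealTriangulation

variable {N : ℕ} {T : IdealTriangulation N}

theorem IsInverseChart.mem_posVariety {e : Fin N ≃ T.Edge} {θ : T.NormalCurve} {U : Set ℂ}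
    {y : ℂ → Fin N → ℂ} (hy : IsInverseChart e θ U y) {w : ℂ} (hw : w ∈ U) :
    y w ∈ posVariety e := by
  obtain ⟨W, -, hW⟩ := hy.image_isOpen
  exact (hW.subset ⟨w, hw, rfl⟩).1

theorem IsInverseChart.hasFDerivAt {e : Fin N ≃ T.Edge} {θ : T.NormalCurve} {U : Set ℂ}
    {y : ℂ → Fin N → ℂ} (hy : IsInverseChart e θ U y) {w : ℂ} (hw : w ∈ U) :
    HasFDerivAt y (fderiv ℂ y w) w :=
  (hy.holomorphic.differentiableAt (hy.isOpen.mem_nhds hw)).hasFDerivAt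

theorem IsInverseChart.logFormGradient_dotProduct {e : Fin N ≃ T.Edge} {θ : T.NormalCurve}
    {U : Set ℂ} {y : ℂ → Fin N → ℂ} (hy : IsInverseChart e θ U y) {w : ℂ} (hw : w ∈ U) (s : ℂ) :
    logFormGradient θ.coeff (y w) ⬝ᵥ fderiv ℂ y w s = s := by
  have hu := (hasStrictFDerivAt_logForm θ.coeff (hy.mem_posVariety hw).1).hasFDerivAt
  have h := (hu.comp w (hy.hasFDerivAt hw)).unique
    ((hasFDerivAt_id w).congr_of_eventuallyEq (by
      filter_upwards [hy.isOpen.mem_nhds hw] with x hx using hy.logParam_eq x hx))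
  simpa [dotProduct, -fderiv_eq_smul_deriv] using DFunLike.congr_fun h s

theorem IsInverseChart.gluingJacobian_mulVec {e : Fin N ≃ T.Edge} {θ : T.NormalCurve}
    {U : Set ℂ} {y : ℂ → Fin N → ℂ} (hy : IsInverseChart e θ U y) {w : ℂ} (hw : w ∈ U) (s : ℂ) :
    (gluingJacobian e (y w)).mulVec (fderiv ℂ y w s) = 0 := by
  have hg := hasFDerivAt_gluingMap e (hy.mem_posVariety hw)
  have h := (hg.comp w (hy.hasFDerivAt hw)).unique
    ((hasFDerivAt_const (1 : Fin N → ℂ) w).congr_of_eventuallyEq (by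
      filter_upwards [hy.isOpen.mem_nhds hw] with x hx using (hy.mem_posVariety hx).2))
  simpa [-fderiv_eq_smul_deriv] using DFunLike.congr_fun h s

/-- The kernel of the Jacobian is contained in the tangent line of the chart: a curve `γ` in the
positive gluing variety through `y w` satisfies `γ = y ∘ u ∘ γ`, where `u` is the log-parameter. -/
theorem IsInverseChart.exists_fderiv_eq {e : Fin N ≃ T.Edge} {θ : T.NormalCurve}
    {U : Set ℂ} {y : ℂ → Fin N → ℂ} (hy : IsInverseChart e θ U y) {w : ℂ} (hw : w ∈ U)
    {v : Fin N → ℂ} (hv : (gluingJacobian e (y w)).mulVec v = 0) :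
    ∃ s, fderiv ℂ y w s = v := by
  have hz := hy.mem_posVariety hw
  have hopen := isOpen_upperHalfSpace.mem_nhds hz.1
  obtain ⟨γ, h0, hd, hγ⟩ :=
    (hasStrictFDerivAt_logGluingMap e hz.1).exists_curve_of_sub_mem_range (v := v)
      (by filter_upwards [hopen] with x hx using logGluingMap_sub_mem_range e hz.1 hx) (by simpa)
  have hγc : Filter.Tendsto γ (nhds 0) (nhds (y w)) := by
    simpa [h0] using hd.continuousAt.tendsto
  obtain ⟨W, hW, hyW⟩ := hy.image_isOpen
  have hγy : ∀ᶠ t in nhds 0, γ t = y (logForm θ.coeff (γ t)) := by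
    filter_upwards [hγ, hγc hopen, hγc (hW.mem_nhds (hyW.subset ⟨w, hw, rfl⟩).2)] with t h1 h2 h3
    have hmem : γ t ∈ posVariety e := by
      refine ⟨h2, funext fun i => ?_⟩
      rw [← exp_logGluingMap e h2, h1, exp_logGluingMap e hz.1, hz.2]
    obtain ⟨x, hx, hxγ⟩ := hyW.superset ⟨hmem, h3⟩
    rw [← hxγ]
    exact congrArg y (hy.logParam_eq x hx).symm
  have hu := (hasStrictFDerivAt_logForm θ.coeff hz.1).hasFDerivAt
  rw [← h0] at hu
  have hcomp := hu.comp_hasDerivAt (0 : ℂ) hd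
  have hyd := hy.hasFDerivAt hw
  have hw0 : w = (logForm θ.coeff ∘ γ) 0 := by
    rw [Function.comp_apply, h0]
    exact (hy.logParam_eq w hw).symm
  rw [hw0] at hyd
  have h := (hyd.comp_hasDerivAt (0 : ℂ) hcomp).congr_of_eventuallyEq hγy
  rw [← hw0] at h
  exact ⟨_, h.unique hd⟩

end IdealTriangulation

/-! ### Determinants with a unit row or column -/

namespace Matrix

variable {F ι : Type*} [Field F] [Fintype ι] [DecidableEq ι]

/-- Both sides are the `(l, c)` cofactor. -/
theorem det_updateCol_single_comm (A : Matrix ι ι F) (l c : ι) :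
    (A.updateCol c (Pi.single l 1)).det = (A.updateRow l (Pi.single c 1)).det := by
  rw [← det_transpose, ← updateRow_transpose, ← adjugate_apply, ← adjugate_transpose,
    transpose_apply, adjugate_apply]

/-- If the column `c` of `X` and the row `l` of `Y` vanish outside the entry `(l, c)`, and `X`, `Y`
agree outside this row and column, then both determinants are multiples of the same cofactor. -/
theorem mul_det_eq_mul_det {X Y : Matrix ι ι F} {l c : ι} {a b : F}
    (hX : X.col c = Pi.single l a) (hY : Y.row l = Pi.single c b)
    (hXY : ∀ i ≠ l, ∀ k ≠ c, X i k = Y i k) : b * X.det = a * Y.det := by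
  have hX' : X.det = a * (X.updateRow l (Pi.single c 1)).det := by
    have h : X = X.updateCol c (a • Pi.single l 1) := by
      rw [← Pi.single_smul, smul_eq_mul, mul_one, ← hX]
      exact (updateCol_eq_self X c).symm
    rw [h, det_updateCol_smul, det_updateCol_single_comm, ← h]
  have hY' : Y.det = b * (Y.updateCol c (Pi.single l 1)).det := by
    have h : Y = Y.updateRow l (b • Pi.single c 1) := by
      rw [← Pi.single_smul, smul_eq_mul, mul_one, ← hY]
      exact (updateRow_eq_self Y l).symm
    rw [h, det_updateRow_smul, ← det_updateCol_single_comm, ← h]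
  have hXc (i : ι) (hi : i ≠ l) : X i c = 0 := by
    simpa [hi] using congrFun hX i
  have : X.updateRow l (Pi.single c 1) = Y.updateCol c (Pi.single l 1) := by
    ext i k
    rcases eq_or_ne i l with rfl | hi <;> rcases eq_or_ne k c with rfl | hk
    · simp
    · simpa [hk] using (congrFun hY k).symm
    · simp [hi, hXc i hi]
    · simp [hi, hk, hXY i hi k hk]
  rw [hX', hY', this]
  ring

end Matrix

/-! ### The torsion of a complex of length three -/

section Torsion

variable {F C₀ C₁ C₂ C₃ ι₀ ι₁ ι₂ ι₃ : Type*} [Field F]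
  [AddCommGroup C₀] [Module F C₀] [AddCommGroup C₁] [Module F C₁]
  [AddCommGroup C₂] [Module F C₂] [AddCommGroup C₃] [Module F C₃]
  [Fintype ι₀] [DecidableEq ι₀] [Fintype ι₁] [DecidableEq ι₁]
  [Fintype ι₂] [DecidableEq ι₂] [Fintype ι₃] [DecidableEq ι₃]

theorem IsAcyclicComplex.exists_isTorsion {δ₀ : C₀ →ₗ[F] C₁} {δ₁ : C₁ →ₗ[F] C₂} {δ₂ : C₂ →ₗ[F] C₃}
    (h : IsAcyclicComplex δ₀ δ₁ δ₂) (c₀ : Module.Basis ι₀ F C₀) (c₁ : Module.Basis ι₁ F C₁)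
    (c₂ : Module.Basis ι₂ F C₂) (c₃ : Module.Basis ι₃ F C₃) :
    ∃ τ, IsTorsion δ₀ δ₁ δ₂ c₀ c₁ c₂ c₃ τ := by
  have := Module.Finite.of_basis c₀
  have := Module.Finite.of_basis c₁
  have := Module.Finite.of_basis c₂
  have := Module.Finite.of_basis c₃
  have hk₀ : LinearMap.ker δ₀ = ⊥ := LinearMap.ker_eq_bot.2 h.1
  have hk₁ := LinearMap.exact_iff.1 h.2.1
  have hk₂ := LinearMap.exact_iff.1 h.2.2.1
  have hr₃ : LinearMap.range δ₂ = ⊤ := LinearMap.range_eq_top.2 h.2.2.2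
  have d₀ := LinearMap.finrank_range_add_finrank_ker δ₀
  have d₁ := LinearMap.finrank_range_add_finrank_ker δ₁
  have d₂ := LinearMap.finrank_range_add_finrank_ker δ₂
  rw [hk₀, finrank_bot, add_zero, Module.finrank_eq_card_basis c₀] at d₀
  rw [hk₁, Module.finrank_eq_card_basis c₁] at d₁
  rw [hk₂, Module.finrank_eq_card_basis c₂] at d₂
  have d₃ : Module.finrank F (LinearMap.range δ₂) = Fintype.card ι₃ := by
    rw [hr₃, finrank_top, Module.finrank_eq_card_basis c₃]
  let b₁ := Module.finBasis F (LinearMap.range δ₀)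
  let b₂ := Module.finBasis F (LinearMap.range δ₁)
  let b₃ := Module.finBasis F (LinearMap.range δ₂)
  choose s₀ hs₀ using fun r => (b₁ r).2
  choose s₁ hs₁ using fun r => (b₂ r).2
  choose s₂ hs₂ using fun r => (b₃ r).2
  exact ⟨_, h, _, _, _, b₁, b₂, b₃, s₀, s₁, s₂, Fintype.equivOfCardEq (by simp [d₀]),
    Fintype.equivOfCardEq (by simp; omega), Fintype.equivOfCardEq (by simp; omega),
    Fintype.equivOfCardEq (by simp [d₃]), 1, hs₀, hs₁, hs₂, rfl⟩

theorem IsTorsion.neg {δ₀ : C₀ →ₗ[F] C₁} {δ₁ : C₁ →ₗ[F] C₂} {δ₂ : C₂ →ₗ[F] C₃}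
    {c₀ : Module.Basis ι₀ F C₀} {c₁ : Module.Basis ι₁ F C₁}
    {c₂ : Module.Basis ι₂ F C₂} {c₃ : Module.Basis ι₃ F C₃} {τ : F}
    (h : IsTorsion δ₀ δ₁ δ₂ c₀ c₁ c₂ c₃ τ) : IsTorsion δ₀ δ₁ δ₂ c₀ c₁ c₂ c₃ (-τ) := by
  obtain ⟨h, m₁, m₂, m₃, b₁, b₂, b₃, s₀, s₁, s₂, e₀, e₁, e₂, e₃, ε, hs₀, hs₁, hs₂, hτ⟩ := h
  refine ⟨h, m₁, m₂, m₃, b₁, b₂, b₃, s₀, s₁, s₂, e₀, e₁, e₂, e₃, -ε, hs₀, hs₁, hs₂, ?_⟩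
  rw [hτ]
  push_cast
  ring

theorem linearIndependent_sumElim_lift {δ₀ : C₀ →ₗ[F] C₁} {δ₁ : C₁ →ₗ[F] C₂}
    (h : Function.Exact δ₀ δ₁) {κ₁ κ₂ : Type*} [Fintype κ₁] [Fintype κ₂]
    (b₁ : Module.Basis κ₁ F (LinearMap.range δ₀)) (b₂ : Module.Basis κ₂ F (LinearMap.range δ₁))
    {s : κ₂ → C₁} (hs : ∀ r, δ₁ (s r) = b₂ r) :
    LinearIndependent F (Sum.elim (fun r => (b₁ r : C₁)) s) := by
  have h₁ : LinearIndependent F fun r => (b₁ r : C₁) :=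
    b₁.linearIndependent.map' (Submodule.subtype _) (Submodule.ker_subtype _)
  have h₂ : LinearIndependent F fun r => (b₂ r : C₂) :=
    b₂.linearIndependent.map' (Submodule.subtype _) (Submodule.ker_subtype _)
  have hb (r : κ₁) : δ₁ (b₁ r) = 0 := (h _).2 (b₁ r).2
  rw [Fintype.linearIndependent_iff] at h₁ h₂ ⊢
  intro g hg
  simp only [Fintype.sum_sum_type, Sum.elim_inl, Sum.elim_inr] at hg
  have hr : ∀ r, g (Sum.inr r) = 0 := h₂ _ (by simpa [hb, hs] using congrArg δ₁ hg)
  have hl : ∀ r, g (Sum.inl r) = 0 := h₁ _ (by simpa [hr] using hg)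
  rintro (r | r)
  exacts [hl r, hr r]

/-- The torsion of an acyclic complex `0 → F → F^ι → F^ι → F → 0` whose middle map is the matrix `J`
and whose last map is `k` times the sum of the coordinates is `± k⁻¹ det Ĵ`, where `Ĵ` is `J` with
one row replaced by a functional `u` that takes the value `1` on the image of the generator. -/
theorem isTorsion_mulVecLin_iff {ι : Type*} [Fintype ι] [DecidableEq ι] {δ₀ : F →ₗ[F] (ι → F)}
    {J : Matrix ι ι F} {δ₂ : (ι → F) →ₗ[F] F} (h : IsAcyclicComplex δ₀ J.mulVecLin δ₂)
    {u : ι → F} (hu : u ⬝ᵥ δ₀ 1 = 1) {k : F} (hk : k ≠ 0) (hδ₂ : ∀ x, δ₂ x = k * ∑ i, x i)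
    (l : ι) (τ : F) :
    IsTorsion δ₀ J.mulVecLin δ₂ (Module.Basis.singleton Unit F) (Pi.basisFun F ι)
        (Pi.basisFun F ι) (Module.Basis.singleton Unit F) τ ↔
      τ = 1 / k * (J.updateRow l u).det ∨ τ = -(1 / k * (J.updateRow l u).det) := by
  have key {τ : F} (hτ : IsTorsion δ₀ J.mulVecLin δ₂ (Module.Basis.singleton Unit F)
      (Pi.basisFun F ι) (Pi.basisFun F ι) (Module.Basis.singleton Unit F) τ) :
      τ = 1 / k * (J.updateRow l u).det ∨ τ = -(1 / k * (J.updateRow l u).det) := by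
    obtain ⟨-, m₁, m₂, m₃, b₁, b₂, b₃, s₀, s₁, s₂, e₀, e₁, e₂, e₃, ε, hs₀, hs₁, hs₂, hτ⟩ := hτ
    obtain rfl : m₁ = 1 := by simpa using (Fintype.card_congr e₀).symm
    obtain rfl : m₃ = 1 := by simpa using (Fintype.card_congr e₃).symm
    set lam := s₀ 0 with hlam
    set β : F := (b₃ 0 : F) with hβ
    have hb₁ : (b₁ 0 : ι → F) = lam • δ₀ 1 := by
      rw [← hs₀, ← map_smul, smul_eq_mul, mul_one]
    have hβ0 : β ≠ 0 := fun h => b₃.ne_zero 0 (Subtype.ext h)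
    -- The families `bᵢ ∪ sᵢ` as matrices, with the vectors of `b₂ ∪ s₂` in the order of
    -- their counterparts in `b₁ ∪ s₁`.
    let v₁ := Sum.elim (fun r => (b₁ r : ι → F)) s₁
    let v₂ := Sum.elim (fun r => (b₂ r : ι → F)) s₂
    let A : Matrix ι ι F := Matrix.of fun i k => v₁ (e₁ k) i
    let B : Matrix ι ι F := Matrix.of fun i k => v₂ ((e₁ k).swap) i
    let c : ι := e₁.symm (Sum.inl 0)
    have hA : (Pi.basisFun F ι).det (v₁ ∘ e₁) = A.det := by
      rw [Module.Basis.det_apply]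
      rfl
    have hA0 : A.det ≠ 0 := by
      have hli : LinearIndependent F (v₁ ∘ e₁) :=
        (linearIndependent_sumElim_lift h.2.1 b₁ b₂ hs₁).comp _ e₁.injective
      rw [← hA]
      exact ((Pi.basisFun F ι).is_basis_iff_det.1
        ⟨hli, (hli.span_eq_top_of_card_eq_finrank' (by simp))⟩).ne_zero
    have hB : ∃ ε' : ℤˣ, (Pi.basisFun F ι).det (v₂ ∘ e₂) = ((ε' : ℤ) : F) * B.det := by
      let π : Equiv.Perm ι := e₂.trans ((Equiv.sumComm _ _).trans e₁.symm)
      have : v₂ ∘ e₂ = (fun k => v₂ (e₁ k).swap) ∘ π := by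
        ext k
        simp [π]
      refine ⟨Equiv.Perm.sign π, ?_⟩
      rw [this, AlternatingMap.map_perm, Module.Basis.det_apply, Units.smul_def, zsmul_eq_mul]
      rfl
    obtain ⟨ε', hε'⟩ := hB
    -- `X` and `Y` are the two families after multiplication by the modified Jacobian, and after
    -- replacing the coordinate `l` by the sum of all coordinates.
    let X := J.updateRow l u * A
    let Y := B.updateRow l fun k => ∑ i, B i k
    have hY : Y.det = B.det := by
      have h := B.det_updateRow_sum l (fun _ => 1)
      have h' : (fun k => ∑ i, B i k) = ∑ i, (1 : F) • B i := by
        ext k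
        simpa using (Finset.sum_apply k Finset.univ fun i => B i).symm
      simp only [Y, h']
      simpa using h
    have hXY : β / k * X.det = lam * Y.det := by
      have hXi (i : ι) (hi : i ≠ l) (k : ι) : X i k = J.mulVec (v₁ (e₁ k)) i := by
        simp [X, Matrix.mul_apply, Matrix.mulVec, dotProduct, hi, A]
      have hXl (k : ι) : X l k = u ⬝ᵥ v₁ (e₁ k) := by
        simp [X, Matrix.mul_apply, dotProduct, A]
      refine Matrix.mul_det_eq_mul_det (l := l) (c := c) ?_ ?_ ?_
      · ext i
        rcases eq_or_ne i l with rfl | hi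
        · simp [hXl, c, v₁, hb₁, hu]
        · have : J.mulVec (δ₀ 1) = 0 := (h.2.1 _).2 ⟨1, rfl⟩
          simp [hXi i hi, c, v₁, hb₁, hi, Matrix.mulVec_smul, this]
      · ext j
        obtain ⟨r, rfl⟩ := e₁.symm.surjective j
        rcases r with r | r
        · obtain rfl := Subsingleton.elim r 0
          have := hs₂ 0
          rw [hδ₂] at this
          simp [Y, B, v₂, c, eq_div_iff hk, ← this, hβ, mul_comm]
        · have : δ₂ (b₂ r) = 0 := (h.2.2.1 _).2 (b₂ r).2
          rw [hδ₂, mul_eq_zero, or_iff_right hk] at this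
          simp [Y, B, v₂, c, this]
      · intro i hi j hj
        obtain ⟨r, rfl⟩ := e₁.symm.surjective j
        rcases r with r | r
        · exact absurd (by rw [Subsingleton.elim r 0]) hj
        · rw [hXi i hi]
          simpa [Y, B, v₁, v₂, hi] using congrFun (hs₁ r) i
    have hc₀ : (Module.Basis.singleton Unit F).det (s₀ ∘ e₀) = lam := by
      rw [Module.Basis.det_apply, Matrix.det_unique]
      simp [Module.Basis.toMatrix_apply, hlam]
      congr 1
      exact Subsingleton.elim _ _
    have hc₃ : (Module.Basis.singleton Unit F).det ((fun r => (b₃ r : F)) ∘ e₃) = β := by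
      rw [Module.Basis.det_apply, Matrix.det_unique]
      simp [Module.Basis.toMatrix_apply, hβ]
      congr 2
      exact Subsingleton.elim _ _
    have hτ' : τ = ((ε : ℤ) : F) * ((ε' : ℤ) : F) * (1 / k * (J.updateRow l u).det) := by
      rw [hτ, hc₀, hc₃, hA, hε']
      rw [hY, Matrix.det_mul] at hXY
      field_simp at hXY ⊢
      linear_combination -((ε : ℤ) : F) * ((ε' : ℤ) : F) * hXY
    rcases Int.units_eq_one_or ε with rfl | rfl <;> rcases Int.units_eq_one_or ε' with rfl | rfl <;>
      simp [hτ']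
  refine ⟨key, fun hτ => ?_⟩
  obtain ⟨τ₀, hτ₀⟩ := h.exists_isTorsion (Module.Basis.singleton Unit F) (Pi.basisFun F ι)
    (Pi.basisFun F ι) (Module.Basis.singleton Unit F)
  rcases hτ with rfl | rfl <;> rcases key hτ₀ with h₀ | h₀
  · exact h₀ ▸ hτ₀
  · simpa [h₀] using hτ₀.neg
  · exact h₀ ▸ hτ₀.neg
  · exact h₀ ▸ hτ₀

end Torsion

/-! ### The tangential gluing complex -/

namespace IdealTriangulation

variable {N : ℕ} {T : IdealTriangulation N}

theorem endCount_eq_two {v : T.Vertex} (hv : ∀ v' : T.Vertex, v' = v) (E : T.Edge) :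
    T.endCount v E = 2 := by
  induction E using Quot.ind with
  | mk d => simp [endCount, hv]

theorem hasFDerivAt_vertexMap (e : Fin N ≃ T.Edge) {v : T.Vertex}
    (hv : ∀ v' : T.Vertex, v' = v) :
    HasFDerivAt (vertexMap e v)
      (∑ i, (2 : ℂ) • ContinuousLinearMap.proj (R := ℂ) (φ := fun _ : Fin N => ℂ) i) 1 := by
  have hfun : vertexMap e v = fun x => ∏ i,
      ContinuousLinearMap.proj (R := ℂ) (φ := fun _ : Fin N => ℂ) i x ^ 2 := by
    ext x
    simp [vertexMap, endCount_eq_two hv]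
  rw [hfun]
  refine (HasFDerivAt.finsetProd fun i _ => (ContinuousLinearMap.proj (R := ℂ)
    (φ := fun _ : Fin N => ℂ) i).hasFDerivAt.pow 2).congr_fderiv ?_
  simp

theorem hatJacobian_eq_updateRow (e : Fin N ≃ T.Edge) (θ : T.NormalCurve) (z : Fin N → ℂ)
    {l : Fin N} (hl : (l : ℕ) + 1 = N) :
    hatJacobian e θ z = (gluingJacobian e z).updateRow l (logFormGradient θ.coeff z) := by
  ext i j
  have hN : (i : ℕ) + 1 < N ↔ i ≠ l := by
    rw [ne_eq, Fin.ext_iff]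
    omega
  rcases eq_or_ne i l with rfl | hi
  · simp [hatJacobian, Matrix.sum_apply, gluingHat, logFormGradient, hN]
  · simp [hatJacobian, Matrix.sum_apply, gluingHat, gluingJacobian, logFormGradient, hN, hi]

theorem IsInverseChart.isAcyclicComplex {e : Fin N ≃ T.Edge} {θ : T.NormalCurve}
    {U : Set ℂ} {y : ℂ → Fin N → ℂ} (hy : IsInverseChart e θ U y) {w : ℂ} (hw : w ∈ U)
    [NeZero N] {δ : (Fin N → ℂ) →ₗ[ℂ] ℂ} {k : ℂ} (hk : k ≠ 0) (hδ : ∀ x, δ x = k * ∑ i, x i) :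
    IsAcyclicComplex (fderiv ℂ y w : ℂ →ₗ[ℂ] (Fin N → ℂ)) (gluingJacobian e (y w)).mulVecLin δ := by
  have hinj : Function.Injective (fderiv ℂ y w : ℂ →ₗ[ℂ] (Fin N → ℂ)) := fun s s' h => by
    rw [← hy.logFormGradient_dotProduct hw s, ← hy.logFormGradient_dotProduct hw s']
    exact congrArg _ h
  have hexact : Function.Exact (fderiv ℂ y w : ℂ →ₗ[ℂ] (Fin N → ℂ))
      (gluingJacobian e (y w)).mulVecLin := fun x =>
    ⟨fun hx => hy.exists_fderiv_eq hw hx, fun ⟨s, hs⟩ => hs ▸ hy.gluingJacobian_mulVec hw s⟩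
  have hsurj : Function.Surjective δ := fun c =>
    ⟨Pi.single 0 (c / k), by simp [hδ, mul_div_cancel₀ _ hk]⟩
  refine ⟨hinj, hexact, LinearMap.exact_iff.2 (Eq.symm ?_), hsurj⟩
  refine Submodule.eq_of_le_of_finrank_eq ?_ ?_
  · rintro _ ⟨x, rfl⟩
    simp only [LinearMap.mem_ker, hδ, Matrix.mulVecLin_apply, Matrix.mulVec, dotProduct]
    rw [Finset.sum_comm]
    simp [← Finset.sum_mul, sum_gluingJacobian e (hy.mem_posVariety hw).1]
  · have d₁ := LinearMap.finrank_range_add_finrank_ker (gluingJacobian e (y w)).mulVecLin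
    have d₂ := LinearMap.finrank_range_add_finrank_ker δ
    rw [LinearMap.exact_iff.1 hexact, LinearMap.finrank_range_of_inj hinj] at d₁
    rw [LinearMap.range_eq_top.2 hsurj, finrank_top] at d₂
    omega

end IdealTriangulation

open IdealTriangulation in
/-- `v` is the only ideal vertex; the link of `v` is a closed connected oriented surface of Euler
characteristic `2 (number of edges - N)`, so that the numbering `e` of the edges by `Fin N` says
that it is a torus. -/
theorem lemma5p1 {N : ℕ} (T : IdealTriangulation N) (v : T.Vertex) (hv : ∀ v' : T.Vertex, v' = v)
    (e : Fin N ≃ T.Edge) (θ : T.NormalCurve)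
    (U : Set ℂ) (y : ℂ → Fin N → ℂ) (hy : IsInverseChart e θ U y) (w : ℂ) (hw : w ∈ U) :
    IsAcyclicComplex
      (fderiv ℂ y w : ℂ →ₗ[ℂ] (Fin N → ℂ))
      (fderiv ℂ (gluingMap e) (y w) : (Fin N → ℂ) →ₗ[ℂ] (Fin N → ℂ))
      (fderiv ℂ (vertexMap e v) 1 : (Fin N → ℂ) →ₗ[ℂ] ℂ) ∧
    ∀ τ : ℂ,
      IsTorsion
        (fderiv ℂ y w : ℂ →ₗ[ℂ] (Fin N → ℂ))
        (fderiv ℂ (gluingMap e) (y w) : (Fin N → ℂ) →ₗ[ℂ] (Fin N → ℂ))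
        (fderiv ℂ (vertexMap e v) 1 : (Fin N → ℂ) →ₗ[ℂ] ℂ)
        (Module.Basis.singleton Unit ℂ) (Pi.basisFun ℂ (Fin N)) (Pi.basisFun ℂ (Fin N))
        (Module.Basis.singleton Unit ℂ) τ ↔
      τ = 1 / 2 * (hatJacobian e θ (y w)).det ∨ τ = -(1 / 2 * (hatJacobian e θ (y w)).det) := by
  have : NeZero N := by
    obtain ⟨t, -⟩ := v.exists_rep.choose
    exact ⟨fun h => (h ▸ t).elim0⟩
  obtain ⟨l, hl⟩ : ∃ l : Fin N, (l : ℕ) + 1 = N :=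
    ⟨⟨N - 1, Nat.sub_one_lt (NeZero.ne N)⟩, Nat.sub_one_add_one (NeZero.ne N)⟩
  have hg : (fderiv ℂ (gluingMap e) (y w) : (Fin N → ℂ) →ₗ[ℂ] (Fin N → ℂ)) =
      (gluingJacobian e (y w)).mulVecLin := by
    rw [(hasFDerivAt_gluingMap e (hy.mem_posVariety hw)).fderiv]
    rfl
  have hp (x : Fin N → ℂ) : (fderiv ℂ (vertexMap e v) 1 : (Fin N → ℂ) →ₗ[ℂ] ℂ) x =
      2 * ∑ i, x i := by
    simp [(hasFDerivAt_vertexMap e hv).fderiv, Finset.mul_sum]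
  rw [hg, hatJacobian_eq_updateRow e θ (y w) hl]
  have h := hy.isAcyclicComplex hw two_ne_zero hp
  exact ⟨h, isTorsion_mulVecLin_iff h (hy.logFormGradient_dotProduct hw 1) two_ne_zero hp l⟩
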